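/- Let $X$ be a Polish space equipped with a metric $\rho$ inducing its topology and with its Borel $\sigma$-field, let $\mu$ be a Borel probability measure on $X$, let $p\ge 2$ be a real number and let $a>0$. For $n\in\mathbb{N}$ let $\mu^n$ be the $n$-fold product measure on $X^n$, let $\rho_p^n(x,y)=\big[\sum_{i=1}^n\rho(x^i,y^i)^p\big]^{1/p}$ for $x,y\in X^n$, and for $A\subset X^n$ and $r\ge 0$ let $$A^r=\{x\in X^n : \text{there is } \bar x\in A \text{ with } \rho_p^n(x,\bar x)\le r\}.$$ (For $A$ Borel, $A^r$ is measurable for the completion of $\mu^n$, and $\mu^n(A^r)$ is understood in this sense.) Let $\mathrm{P}_p(X)$ be the set of Borel probability measures $\nu$ on $X$ with $\int\rho(x_o,x)^p\,d\nu(x)<\infty$ for some $x_o\in X$. For Borel probability measures $\nu_1,\nu_2$ on $X$ let $$\mathcal{T}_p(\nu_1,\nu_2)=\inf_\pi\int\rho(x,y)^p\,d\pi(x,y)\in[0,\infty],$$ the infimum being over all probability measures $\pi$ on $X\times X$ with first marginal $\nu_1$ and second marginal $\nu_2$. Let $\operatorname{H}(\nu\,|\,\mu)=\int\log\frac{d\nu}{d\mu}\,d\nu$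 if $\nu\ll\mu$, and $\operatorname{H}(\nu\,|\,\mu)=+\infty$ otherwise. Then the following are equivalent: (1) There are $r_o,b\ge 0$ such that for every $n$, every measurable $A\subset X^n$ with $\mu^n(A)\ge 1/2$ and every $r\ge r_o$, $$\mu^n(A^r)\ge 1-b\,e^{-a(r-r_o)^p}.$$ (2) For every $\nu\in\mathrm{P}_p(X)$, $$\mathcal{T}_p(\nu,\mu)\le a^{-1}\operatorname{H}(\nu\,|\,\mu).$$ -/

import Mathlib

open MeasureTheory
open scoped ENNReal

noncomputable section

/-- `P_p(X)`: the Borel probability measures on `X` with finite moment of order `p`. -/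
def finiteMomentMeasures {X : Type*} [MetricSpace X] [MeasurableSpace X] (p : ℝ) :
    Set (Measure X) :=
  {ν | IsProbabilityMeasure ν ∧ ∃ x₀ : X, ∫⁻ x, ENNReal.ofReal (dist x₀ x ^ p) ∂ν < ∞}

/-- The couplings of `ν₁` and `ν₂`: the probability measures on `X × X` whose first and second
marginals are `ν₁` and `ν₂`. -/
def couplings {X : Type*} [MeasurableSpace X] (ν₁ ν₂ : Measure X) : Set (Measure (X × X)) :=
  {π | IsProbabilityMeasure π ∧ π.map Prod.fst = ν₁ ∧ π.map Prod.snd = ν₂}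

/-- The optimal transportation cost `inf_π ∫ ρ(x, y)^p dπ(x, y)` over the couplings `π` of
`ν₁` and `ν₂`, with values in `[0, ∞]`. -/
def transportCost {X : Type*} [MetricSpace X] [MeasurableSpace X] (p : ℝ)
    (ν₁ ν₂ : Measure X) : ℝ≥0∞ :=
  ⨅ π ∈ couplings ν₁ ν₂, ∫⁻ z, ENNReal.ofReal (dist z.1 z.2 ^ p) ∂π

/-- The metric `(∑ i, ρ(x i, y i)^p)^(1/p)` on the `n`-fold product of `X`. -/
def lpProductDist {X : Type*} [MetricSpace X] (p : ℝ) {n : ℕ} (x y : Fin n → X) : ℝ :=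
  (∑ i, dist (x i) (y i) ^ p) ^ (1 / p)

/-- The `r`-enlargement of `A` for the `ℓ^p` product metric. -/
def lpEnlargement {X : Type*} [MetricSpace X] (p : ℝ) {n : ℕ} (A : Set (Fin n → X)) (r : ℝ) :
    Set (Fin n → X) :=
  {x | ∃ y ∈ A, lpProductDist p x y ≤ r}

end

open Filter Topology Set

/-! Transport to concentration: write `Q g` for the infimal convolution of `g` with the cost.
Testing the transport inequality on the measure with density proportional to `exp (a * Q g)` turns
it into `∫ exp (a * Q g) dμ ≤ exp (a * ∫ g dμ)` (`infConvIneq_of_transportCost_le`). This form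
tensorizes with the same `a` (`InfConvIneq.prod`), and multiples of the truncated distance to `A`
then give concentration, with `b = 1` (`InfConvIneq.concentration`).

Concentration to transport: this is a large deviation argument. If `T_p(ν, μ) > c > H(ν | μ) / a`,
then by lower semicontinuity `T_p > c` on a product of weak neighbourhoods of `ν` and `μ`. Samples
whose empirical measures lie in these neighbourhoods are more than `(n c)^(1/p)` apart, so
concentration makes the samples near `ν` cost about `exp (-a n c)` under `μ^n`. A change of measure
bounds that probability below by about `exp (-n H)`, a contradiction
(`transportCost_le_of_concentration`). -/

/-- The infimal convolution of `g` with the cost `c`. -/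
noncomputable def infConv {Z : Type*} (c : Z → Z → ℝ) (g : Z → ℝ) (x : Z) : ℝ :=
  ⨅ y, (g y + c x y)

/-! ### Bounds and measurability of infimal convolutions. -/

section InfConv

variable {Z : Type*} {c : Z → Z → ℝ} {g : Z → ℝ} {M : ℝ}

lemma bddBelow_range_add_cost (hc : ∀ x y, 0 ≤ c x y) (hg : ∀ z, |g z| ≤ M) (x : Z) :
    BddBelow (range fun y => g y + c x y) := by
  refine ⟨-M, ?_⟩
  rintro _ ⟨y, rfl⟩
  have := (abs_le.1 (hg y)).1
  have := hc x y
  simp only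
  linarith

lemma infConv_le (hc : ∀ x y, 0 ≤ c x y) (hg : ∀ z, |g z| ≤ M) (x y : Z) :
    infConv c g x ≤ g y + c x y :=
  ciInf_le (bddBelow_range_add_cost hc hg x) y

lemma abs_infConv_le (hc : ∀ x y, 0 ≤ c x y) (hc0 : ∀ x, c x x = 0) (hg : ∀ z, |g z| ≤ M)
    (x : Z) : |infConv c g x| ≤ M := by
  have : Nonempty Z := ⟨x⟩
  rw [abs_le]
  constructor
  · refine le_ciInf fun y => ?_
    have := (abs_le.1 (hg y)).1
    have := hc x y
    linarith
  · have h := infConv_le hc hg x x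
    have := (abs_le.1 (hg x)).2
    rw [hc0] at h
    linarith

/-- The infimum is uncountable, but an infimum of functions continuous in `x` is upper
semicontinuous, hence Borel. -/
lemma measurable_infConv [TopologicalSpace Z] [MeasurableSpace Z] [OpensMeasurableSpace Z]
    (hc : ∀ x y, 0 ≤ c x y) (hcont : ∀ y, Continuous fun x => c x y) (hg : ∀ z, |g z| ≤ M) :
    Measurable (infConv c g) := by
  refine UpperSemicontinuous.measurable ?_
  exact upperSemicontinuous_ciInf (fun x => bddBelow_range_add_cost hc hg x)
    fun y => (continuous_const.add (hcont y)).upperSemicontinuous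

end InfConv

/-! ### Entropy of exponentially tilted measures. -/

section Tilted

variable {α : Type*} [MeasurableSpace α] {μ : Measure α} [IsProbabilityMeasure μ] {f : α → ℝ}

/-- The log-density is `f` minus the log-normalizer. The sign is recorded so that `ENNReal.ofReal`
can be removed later. -/
lemma klDiv_tilted_left (hf : Integrable (fun x => Real.exp (f x)) μ)
    (hf' : Integrable f (μ.tilted f)) :
    InformationTheory.klDiv (μ.tilted f) μ =
        ENNReal.ofReal (∫ x, f x ∂(μ.tilted f) - Real.log (∫ x, Real.exp (f x) ∂μ)) ∧
      0 ≤ ∫ x, f x ∂(μ.tilted f) - Real.log (∫ x, Real.exp (f x) ∂μ) := by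
  have := isProbabilityMeasure_tilted hf
  have hac := tilted_absolutelyContinuous μ f
  have hllr : llr (μ.tilted f) μ =ᵐ[μ.tilted f]
      fun x => f x - Real.log (∫ x, Real.exp (f x) ∂μ) :=
    hac.ae_le (log_rnDeriv_tilted_left_self hf)
  have hint : Integrable (llr (μ.tilted f) μ) (μ.tilted f) :=
    (hf'.sub (integrable_const _)).congr hllr.symm
  have heq : ∫ x, llr (μ.tilted f) μ x ∂(μ.tilted f) =
      ∫ x, f x ∂(μ.tilted f) - Real.log (∫ x, Real.exp (f x) ∂μ) := by
    rw [integral_congr_ae hllr, integral_sub hf' (integrable_const _)]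
    simp
  have h0 := InformationTheory.integral_llr_add_sub_measure_univ_nonneg hac hint
  rw [InformationTheory.klDiv_of_ac_of_integrable hac hint]
  simp only [heq, probReal_univ, add_sub_cancel_right] at h0 ⊢
  exact ⟨trivial, h0⟩

end Tilted

/-! ### The dual form of the transport inequality on `X`. -/

section OneDim

section MetricSpace

variable {X : Type*} [MetricSpace X] {p : ℝ}

lemma dist_rpow_le_two_rpow_mul (hp : 0 ≤ p) (x y z : X) :
    dist x z ^ p ≤ 2 ^ p * (dist x y ^ p + dist y z ^ p) := by
  have h1 : dist x z ≤ 2 * max (dist x y) (dist y z) := by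
    have := dist_triangle x y z
    have := le_max_left (dist x y) (dist y z)
    have := le_max_right (dist x y) (dist y z)
    linarith
  calc dist x z ^ p ≤ (2 * max (dist x y) (dist y z)) ^ p :=
        Real.rpow_le_rpow dist_nonneg h1 hp
    _ = 2 ^ p * (max (dist x y) (dist y z)) ^ p :=
        Real.mul_rpow (by norm_num) (le_max_of_le_left dist_nonneg)
    _ ≤ _ := by
        gcongr
        have h2 : 0 ≤ dist x y ^ p := by positivity
        have h3 : 0 ≤ dist y z ^ p := by positivity
        rcases max_choice (dist x y) (dist y z) with h | h <;> rw [h] <;> linarith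

lemma continuous_dist_rpow (hp : 0 ≤ p) :
    Continuous fun z : X × X => dist z.1 z.2 ^ p :=
  (continuous_fst.dist continuous_snd).rpow_const fun _ => Or.inr hp

/-- The easy half of Kantorovich duality. -/
lemma ofReal_integral_sub_integral_le_transportCost [MeasurableSpace X] {μ ν : Measure X} {φ g : X → ℝ}
    (hφ : Integrable φ ν) (hg : Integrable g μ)
    (hle : ∀ x y, φ x ≤ g y + dist x y ^ p) :
    ENNReal.ofReal (∫ x, φ x ∂ν - ∫ y, g y ∂μ) ≤ transportCost p ν μ := by
  refine le_iInf₂ fun π hπ => ?_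
  obtain ⟨hπ, rfl, rfl⟩ := hπ
  have hφ' : Integrable (fun z : X × X => φ z.1) π :=
    (integrable_map_measure hφ.1 measurable_fst.aemeasurable).1 hφ
  have hg' : Integrable (fun z : X × X => g z.2) π :=
    (integrable_map_measure hg.1 measurable_snd.aemeasurable).1 hg
  rw [integral_map measurable_fst.aemeasurable hφ.1, integral_map measurable_snd.aemeasurable hg.1,
    ← integral_sub hφ' hg']
  have hint := hφ'.sub hg'
  calc ENNReal.ofReal (∫ z, (φ z.1 - g z.2) ∂π)
      ≤ ENNReal.ofReal (∫ z, max (φ z.1 - g z.2) 0 ∂π) :=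
        ENNReal.ofReal_le_ofReal (integral_mono hint hint.pos_part fun z => le_max_left _ _)
    _ = ∫⁻ z, ENNReal.ofReal (max (φ z.1 - g z.2) 0) ∂π :=
        ofReal_integral_eq_lintegral_ofReal hint.pos_part (ae_of_all _ fun z => le_max_right _ _)
    _ ≤ _ := by
        refine lintegral_mono fun z => ENNReal.ofReal_le_ofReal (max_le ?_ (by positivity))
        linarith [hle z.1 z.2]

end MetricSpace

variable {X : Type*} [MetricSpace X] [PolishSpace X] [MeasurableSpace X]
    [BorelSpace X] {μ : Measure X} [IsProbabilityMeasure μ] {p a : ℝ}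

lemma measurable_dist_rpow (x₀ : X) : Measurable fun x : X => dist x₀ x ^ p :=
  (measurable_const.dist measurable_id).pow_const p

/-- The density proportional to `exp (-dist x₀ x ^ p)` has finite moment and entropy, as `t * exp
(-t)` is bounded. A coupling of finite cost carries the moment over to `μ`. -/
lemma mem_finiteMomentMeasures_of_transportCost_le (hp : 0 < p)
    (h : ∀ ν ∈ finiteMomentMeasures (X := X) p,
      transportCost p ν μ ≤ ENNReal.ofReal a⁻¹ * InformationTheory.klDiv ν μ) :
    μ ∈ finiteMomentMeasures (X := X) p := by
  obtain ⟨x₀⟩ : Nonempty X := nonempty_of_isProbabilityMeasure μ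
  have hmeas := measurable_dist_rpow (p := p) x₀
  have hnn : ∀ x, 0 ≤ dist x₀ x ^ p := fun x => by positivity
  set f : X → ℝ := fun x => -(dist x₀ x ^ p) with hf
  have hfm : Measurable f := hmeas.neg
  have hexp : Integrable (fun x => Real.exp (f x)) μ := by
    refine Integrable.of_bound hfm.exp.aestronglyMeasurable 1 (ae_of_all _ fun x => ?_)
    rw [Real.norm_of_nonneg (Real.exp_pos _).le]
    exact Real.exp_le_one_iff.2 (by simp only [hf]; linarith [hnn x])
  have hprob := isProbabilityMeasure_tilted hexp
  have hint : Integrable f (μ.tilted f) := by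
    rw [integrable_tilted_iff hexp]
    refine Integrable.of_bound (hfm.exp.mul hfm).aestronglyMeasurable 1 (ae_of_all _ fun x => ?_)
    rw [norm_smul, Real.norm_of_nonneg (Real.exp_pos _).le, Real.norm_eq_abs]
    simp only [hf, abs_neg, abs_of_nonneg (hnn x), Real.exp_neg]
    rw [inv_mul_le_iff₀ (Real.exp_pos _), mul_one]
    linarith [Real.add_one_le_exp (dist x₀ x ^ p)]
  have hfin : ∫⁻ x, ENNReal.ofReal (dist x₀ x ^ p) ∂(μ.tilted f) < ∞ := by
    have := hint.neg.lintegral_lt_top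
    simpa [hf] using this
  have hlt : transportCost p (μ.tilted f) μ < ∞ := by
    refine (h _ ⟨hprob, x₀, hfin⟩).trans_lt ?_
    rw [(klDiv_tilted_left hexp hint).1]
    exact ENNReal.mul_lt_top ENNReal.ofReal_lt_top ENNReal.ofReal_lt_top
  simp only [transportCost, iInf_lt_iff] at hlt
  obtain ⟨π, ⟨hπ, hπ1, hπ2⟩, hlt⟩ := hlt
  refine ⟨inferInstance, x₀, ?_⟩
  rw [← hπ1, lintegral_map hmeas.ennreal_ofReal measurable_fst] at hfin
  rw [← hπ2, lintegral_map hmeas.ennreal_ofReal measurable_snd]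
  calc ∫⁻ z, ENNReal.ofReal (dist x₀ z.2 ^ p) ∂π
      ≤ ∫⁻ z, ENNReal.ofReal (2 ^ p) * (ENNReal.ofReal (dist x₀ z.1 ^ p)
          + ENNReal.ofReal (dist z.1 z.2 ^ p)) ∂π := by
        refine lintegral_mono fun z => ?_
        rw [← ENNReal.ofReal_add (by positivity) (by positivity),
          ← ENNReal.ofReal_mul (by positivity)]
        exact ENNReal.ofReal_le_ofReal (dist_rpow_le_two_rpow_mul hp.le _ _ _)
    _ = ENNReal.ofReal (2 ^ p) * (∫⁻ z, ENNReal.ofReal (dist x₀ z.1 ^ p) ∂π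
          + ∫⁻ z, ENNReal.ofReal (dist z.1 z.2 ^ p) ∂π) := by
        rw [lintegral_const_mul' _ _ ENNReal.ofReal_ne_top, lintegral_add_left]
        exact (hmeas.comp measurable_fst).ennreal_ofReal
    _ < ∞ := ENNReal.mul_lt_top ENNReal.ofReal_lt_top (ENNReal.add_lt_top.2 ⟨hfin, hlt⟩)

/-- The infimal convolution form of the transportation inequality. -/
def InfConvIneq {Z : Type*} [MeasurableSpace Z] (μ : Measure Z) (c : Z → Z → ℝ) (a : ℝ) : Prop :=
  ∀ g : Z → ℝ, Measurable g → (∃ M, ∀ z, |g z| ≤ M) →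
    ∫⁻ z, ENNReal.ofReal (Real.exp (a * infConv c g z)) ∂μ ≤
      ENNReal.ofReal (Real.exp (a * ∫ z, g z ∂μ))

/-- For `ν` the tilt of `μ` by `a * φ`, `H(ν | μ) = a ∫ φ dν - log Z`. Duality bounds `∫ φ dν - ∫ g
dμ` by `H / a`; the terms `∫ φ dν` cancel, leaving `log Z ≤ a ∫ g dμ`. -/
lemma infConvIneq_of_transportCost_le (hp : 0 < p) (ha : 0 < a)
    (h : ∀ ν ∈ finiteMomentMeasures (X := X) p,
      transportCost p ν μ ≤ ENNReal.ofReal a⁻¹ * InformationTheory.klDiv ν μ) :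
    InfConvIneq μ (fun x y => dist x y ^ p) a := by
  rintro g hg ⟨M, hM⟩
  obtain ⟨-, x₀, hμp⟩ := mem_finiteMomentMeasures_of_transportCost_le hp h
  have hc : ∀ x y : X, 0 ≤ dist x y ^ p := fun x y => by positivity
  have hc0 : ∀ x : X, dist x x ^ p = 0 := fun x => by simp [hp.ne']
  set φ := infConv (fun x y : X => dist x y ^ p) g with hφ
  have hφm : Measurable φ := measurable_infConv hc
    (fun y => (continuous_id.dist continuous_const).rpow_const fun _ => Or.inr hp.le) hM
  have hφM : ∀ x, |φ x| ≤ M := abs_infConv_le hc hc0 hM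
  have hexpM : ∀ x, Real.exp (a * φ x) ≤ Real.exp (a * M) := fun x =>
    Real.exp_le_exp.2 (mul_le_mul_of_nonneg_left (abs_le.1 (hφM x)).2 ha.le)
  have hexp : Integrable (fun x => Real.exp (a * φ x)) μ := by
    refine Integrable.of_bound (hφm.const_mul a).exp.aestronglyMeasurable (Real.exp (a * M))
      (ae_of_all _ fun x => ?_)
    rw [Real.norm_of_nonneg (Real.exp_pos _).le]
    exact hexpM x
  have hprob := isProbabilityMeasure_tilted hexp
  set ν := μ.tilted (fun x => a * φ x) with hν
  set Z := ∫ x, Real.exp (a * φ x) ∂μ with hZ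
  have hZpos : 0 < Z := integral_exp_pos hexp
  have hφν : Integrable φ ν :=
    Integrable.of_bound hφm.aestronglyMeasurable M (ae_of_all _ hφM)
  have hgμ : Integrable g μ := Integrable.of_bound hg.aestronglyMeasurable M (ae_of_all _ hM)
  have hνp : ν ∈ finiteMomentMeasures (X := X) p := by
    refine ⟨hprob, x₀, ?_⟩
    rw [hν, lintegral_tilted]
    calc _ ≤ ∫⁻ x, ENNReal.ofReal (Real.exp (a * M) / Z) * ENNReal.ofReal (dist x₀ x ^ p) ∂μ := by
          refine lintegral_mono fun x => ?_
          gcongr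
          exact (abs_le.1 (hφM x)).2
      _ = ENNReal.ofReal (Real.exp (a * M) / Z) * ∫⁻ x, ENNReal.ofReal (dist x₀ x ^ p) ∂μ :=
          lintegral_const_mul' _ _ ENNReal.ofReal_ne_top
      _ < ∞ := ENNReal.mul_lt_top ENNReal.ofReal_lt_top hμp
  have hkl := klDiv_tilted_left hexp (hφν.const_mul a)
  have hT := (ofReal_integral_sub_integral_le_transportCost (p := p) hφν hgμ
    fun x y => infConv_le hc hM x y).trans (h ν hνp)
  rw [hkl.1, ← ENNReal.ofReal_mul (by positivity),
    ENNReal.ofReal_le_ofReal_iff (mul_nonneg (by positivity) hkl.2),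
    integral_const_mul, inv_mul_eq_div, le_div_iff₀ ha] at hT
  have hlog : Real.log Z ≤ a * ∫ x, g x ∂μ := by linarith
  rw [← ofReal_integral_eq_lintegral_ofReal hexp (ae_of_all _ fun _ => (Real.exp_pos _).le)]
  exact ENNReal.ofReal_le_ofReal ((Real.log_le_iff_le_exp hZpos).1 hlog)

end OneDim

/-! ### Tensorization over product spaces. -/

section Tensorization

variable {Z W : Type*} [MeasurableSpace Z] [MeasurableSpace W] {a : ℝ}

lemma exp_mul_iInf {ι : Type*} [Nonempty ι] (ha : 0 ≤ a) {t : ι → ℝ} (ht : BddBelow (range t)) :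
    ENNReal.ofReal (Real.exp (a * ⨅ i, t i)) = ⨅ i, ENNReal.ofReal (Real.exp (a * t i)) := by
  refine Monotone.map_ciInf_of_continuousAt (f := fun s => ENNReal.ofReal (Real.exp (a * s)))
    ?_ (fun s t hst => ?_) ht
  · exact (ENNReal.continuous_ofReal.comp (by fun_prop)).continuousAt
  · exact ENNReal.ofReal_le_ofReal (Real.exp_le_exp.2 (mul_le_mul_of_nonneg_left hst ha))

/-- Freezing the first coordinate `y` of the minimizer bounds the convolution by `c x y` plus a
convolution in `w` alone. Integrating in `w` and then minimizing over `y` leaves the convolution of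
the partial mean `k`, to which the inequality for `μ` applies. -/
lemma InfConvIneq.prod [TopologicalSpace Z] [TopologicalSpace W]
    [SecondCountableTopology Z] [SecondCountableTopology W]
    [OpensMeasurableSpace Z] [OpensMeasurableSpace W]
    {μ : Measure Z} {ν : Measure W} [IsProbabilityMeasure μ] [IsProbabilityMeasure ν]
    {c : Z → Z → ℝ} {d : W → W → ℝ} (ha : 0 ≤ a)
    (hc : ∀ x y, 0 ≤ c x y) (hd : ∀ x y, 0 ≤ d x y)
    (hccont : ∀ y, Continuous fun x => c x y) (hdcont : ∀ y, Continuous fun x => d x y)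
    (hμ : InfConvIneq μ c a) (hν : InfConvIneq ν d a) :
    InfConvIneq (μ.prod ν) (fun x y => c x.1 y.1 + d x.2 y.2) a := by
  rintro g hg ⟨M, hM⟩
  have hcd : ∀ x y : Z × W, 0 ≤ c x.1 y.1 + d x.2 y.2 := fun x y => add_nonneg (hc _ _) (hd _ _)
  have hQm : Measurable (infConv (fun x y : Z × W => c x.1 y.1 + d x.2 y.2) g) :=
    measurable_infConv hcd
      (fun y => ((hccont y.1).comp continuous_fst).add ((hdcont y.2).comp continuous_snd)) hM
  rw [lintegral_prod _ ((hQm.const_mul a).exp.ennreal_ofReal).aemeasurable]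
  set k : Z → ℝ := fun y => ∫ w, g (y, w) ∂ν with hk
  have hkm : Measurable k := hg.stronglyMeasurable.integral_prod_right'.measurable
  have hkM : ∀ z, |k z| ≤ M := fun z => by
    simpa using norm_integral_le_of_norm_le_const (μ := ν) (f := fun w => g (z, w)) (C := M)
      (ae_of_all _ fun w => hM (z, w))
  have hgint : Integrable g (μ.prod ν) :=
    Integrable.of_bound hg.aestronglyMeasurable M (ae_of_all _ hM)
  rw [integral_prod _ hgint]
  refine le_trans (lintegral_mono fun x => ?_) (hμ k hkm ⟨M, hkM⟩)
  have : Nonempty Z := ⟨x⟩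
  simp only [infConv]
  rw [exp_mul_iInf ha (bddBelow_range_add_cost hc hkM x)]
  refine le_iInf fun y => ?_
  calc ∫⁻ w, ENNReal.ofReal (Real.exp (a * infConv (fun x y : Z × W => c x.1 y.1 + d x.2 y.2) g
          (x, w))) ∂ν
      ≤ ∫⁻ w, ENNReal.ofReal (Real.exp (a * c x y)) *
          ENNReal.ofReal (Real.exp (a * infConv d (fun w => g (y, w)) w)) ∂ν := by
        refine lintegral_mono fun w => ?_
        have : Nonempty W := ⟨w⟩
        have hle : infConv (fun x y : Z × W => c x.1 y.1 + d x.2 y.2) g (x, w) - c x y ≤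
            infConv d (fun w => g (y, w)) w := by
          refine le_ciInf fun w' => ?_
          have := infConv_le hcd hM (x, w) (y, w')
          simp only at this ⊢
          linarith
        rw [← ENNReal.ofReal_mul (Real.exp_pos _).le, ← Real.exp_add, ← mul_add]
        exact ENNReal.ofReal_le_ofReal (Real.exp_le_exp.2
          (mul_le_mul_of_nonneg_left (by linarith) ha))
    _ = ENNReal.ofReal (Real.exp (a * c x y)) *
          ∫⁻ w, ENNReal.ofReal (Real.exp (a * infConv d (fun w => g (y, w)) w)) ∂ν :=
        lintegral_const_mul' _ _ ENNReal.ofReal_ne_top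
    _ ≤ ENNReal.ofReal (Real.exp (a * c x y)) * ENNReal.ofReal (Real.exp (a * k y)) := by
        gcongr
        exact hν _ (hg.comp measurable_prodMk_left) ⟨M, fun w => hM (y, w)⟩
    _ = ENNReal.ofReal (Real.exp (a * (k y + c x y))) := by
        rw [← ENNReal.ofReal_mul (Real.exp_pos _).le, ← Real.exp_add, ← mul_add, add_comm]

lemma InfConvIneq.of_measurePreserving {μ : Measure Z} {ν : Measure W} (e : Z ≃ᵐ W)
    (he : MeasurePreserving e μ ν) {d : W → W → ℝ} (hν : InfConvIneq ν d a) :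
    InfConvIneq μ (fun x y => d (e x) (e y)) a := by
  rintro g hg ⟨M, hM⟩
  have key := hν (g ∘ e.symm) (hg.comp e.symm.measurable) ⟨M, fun z => hM _⟩
  rw [← he.lintegral_comp_emb e.measurableEmbedding,
    ← he.integral_comp e.measurableEmbedding] at key
  have hQ : ∀ z, infConv d (g ∘ e.symm) (e z) = infConv (fun x y => d (e x) (e y)) g z := by
    intro z
    simp only [infConv, Function.comp]
    rw [← e.toEquiv.iInf_comp]
    simp
  simpa [hQ] using key

lemma InfConvIneq.pi [TopologicalSpace Z] [SecondCountableTopology Z] [OpensMeasurableSpace Z]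
    {μ : Measure Z} [IsProbabilityMeasure μ] {c : Z → Z → ℝ} (ha : 0 ≤ a)
    (hc : ∀ x y, 0 ≤ c x y) (hccont : ∀ y, Continuous fun x => c x y)
    (hμ : InfConvIneq μ c a) (n : ℕ) :
    InfConvIneq (Measure.pi fun _ : Fin n => μ) (fun x y => ∑ i, c (x i) (y i)) a := by
  induction n with
  | zero =>
    rintro g hg -
    have hQ : ∀ z, infConv (fun x y : Fin 0 → Z => ∑ i, c (x i) (y i)) g z = g z := by
      intro z
      simp [infConv, Subsingleton.elim z default]
    have hg' : ∀ z, g z = g default := fun z => by rw [Subsingleton.elim z default]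
    simp only [hQ]
    simp [hg']
  | succ n ih =>
    have h := InfConvIneq.of_measurePreserving _
      (measurePreserving_piFinSuccAbove (fun _ : Fin (n + 1) => μ) 0)
      (InfConvIneq.prod ha hc (fun x y => Finset.sum_nonneg fun i _ => hc (x i) (y i)) hccont
        (fun y => continuous_finsetSum _ fun i _ => (hccont (y i)).comp (continuous_apply i))
        hμ ih)
    convert h using 3 with x y
    rw [Fin.sum_univ_succ]
    rfl

end Tensorization

/-! ### From the dual inequality to concentration. -/

section Concentration

variable {p a : ℝ}

/-- Bernoulli's inequality at `t / s - 1`, scaled by `s ^ p`. It trades the cost for a linear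
function of the distance. -/
lemma rpow_tangent_le (hp : 1 ≤ p) {s t : ℝ} (hs : 0 ≤ s) (ht : 0 ≤ t) :
    s ^ p + p * s ^ (p - 1) * (t - s) ≤ t ^ p := by
  rcases hs.eq_or_lt with rfl | hs
  · rcases hp.eq_or_lt with rfl | hp
    · simp
    · rw [Real.zero_rpow (by linarith), Real.zero_rpow (by linarith)]
      simpa using Real.rpow_nonneg ht p
  · have h := one_add_mul_self_le_rpow_one_add (s := t / s - 1)
      (by have : 0 ≤ t / s := by positivity
          linarith) hp
    rw [add_sub_cancel, Real.div_rpow ht hs.le, le_div_iff₀ (by positivity)] at h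
    rw [Real.rpow_sub_one hs.ne']
    calc _ = (1 + p * (t / s - 1)) * s ^ p := by field_simp
      _ ≤ _ := h

variable {Z : Type*} [TopologicalSpace Z] [MeasurableSpace Z] [OpensMeasurableSpace Z]
  {μ : Measure Z} [IsProbabilityMeasure μ] {D : Z → Z → ℝ}

/-- Marton's argument in its dual form. -/
lemma InfConvIneq.concentration (hp : 1 ≤ p) (ha : 0 < a)
    (h : InfConvIneq μ (fun x y => D x y ^ p) a)
    (hD : ∀ x y, 0 ≤ D x y) (hD0 : ∀ x, D x x = 0) (hsymm : ∀ x y, D x y = D y x)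
    (htri : ∀ x y z, D x z ≤ D x y + D y z) (hcont : ∀ y, Continuous fun x => D x y)
    {A : Set Z} (hA : 1 / 2 ≤ μ.real A) {r : ℝ} (hr : (Real.log 2 / a) ^ (1 / p) ≤ r) :
    1 - Real.exp (-a * (r - (Real.log 2 / a) ^ (1 / p)) ^ p) ≤
      μ.real {x | ∃ y ∈ A, D x y ≤ r} := by
  -- Chosen so that `exp (a * s₀ ^ p) = 2` compensates the factor `μ(A) ≥ 1 / 2`.
  set s₀ := (Real.log 2 / a) ^ (1 / p) with hs₀
  have hlog2 : 0 < Real.log 2 := Real.log_pos (by norm_num)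
  have hs₀pos : 0 ≤ s₀ := by positivity
  have hs₀p : a * s₀ ^ p = Real.log 2 := by
    rw [hs₀, one_div, Real.rpow_inv_rpow (by positivity) (by linarith)]
    field_simp
  have hAne : A.Nonempty := by
    rw [nonempty_iff_ne_empty]
    rintro rfl
    norm_num at hA
  have : Nonempty A := hAne.to_subtype
  have hbdd : ∀ x, BddBelow (range fun y : A => D x y) := fun x =>
    ⟨0, by rintro _ ⟨y, rfl⟩; exact hD _ _⟩
  have hr0 : 0 ≤ r := hs₀pos.trans hr
  -- Truncation at `r` keeps `F` bounded, as the dual inequality requires, without changing the set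
  -- `F < r`.
  set F : Z → ℝ := fun x => min r (⨅ y : A, D x y) with hF
  have hFm : Measurable F := measurable_const.min
    (upperSemicontinuous_ciInf hbdd fun y => (hcont y).upperSemicontinuous).measurable
  have hF0 : ∀ x, 0 ≤ F x := fun x => le_min hr0 (le_ciInf fun y => hD _ _)
  have hFr : ∀ x, F x ≤ r := fun x => min_le_left _ _
  have hFM : ∀ x, |F x| ≤ r := fun x => abs_le.2 ⟨by linarith [hF0 x], hFr x⟩
  have hFlip : ∀ x y, F x ≤ F y + D x y := by
    intro x y
    rw [hF]
    simp only
    rw [← min_add_add_right]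
    refine min_le_min (by linarith [hD x y]) ?_
    rw [← sub_le_iff_le_add]
    refine le_ciInf fun z => ?_
    linarith [ciInf_le (hbdd x) z, htri x y z]
  have hFA : ∀ x ∈ A, F x = 0 := by
    intro x hx
    refine le_antisymm ?_ (hF0 x)
    exact (min_le_right _ _).trans ((ciInf_le (hbdd x) ⟨x, hx⟩).trans (hD0 x).le)
  have hFint : Integrable F μ :=
    Integrable.of_bound hFm.aestronglyMeasurable r (ae_of_all _ hFM)
  set m := ∫ x, F x ∂μ with hm
  have markov : ∀ (g : Z → ℝ) (B : Set Z) (t : ℝ), Measurable g → (∃ M, ∀ z, |g z| ≤ M) →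
      (∀ x ∈ B, t ≤ infConv (fun x y => D x y ^ p) g x) →
      Real.exp (a * t) * μ.real B ≤ Real.exp (a * ∫ x, g x ∂μ) := by
    intro g B t hg hM hB
    have h1 := h g hg hM
    have h2 : ENNReal.ofReal (Real.exp (a * t)) * μ B ≤
        ENNReal.ofReal (Real.exp (a * ∫ x, g x ∂μ)) := by
      refine le_trans ?_ h1
      refine le_trans ?_ (mul_meas_ge_le_lintegral₀ ?_ (ENNReal.ofReal (Real.exp (a * t))))
      · gcongr
        intro x hx
        exact ENNReal.ofReal_le_ofReal (Real.exp_le_exp.2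
          (mul_le_mul_of_nonneg_left (hB x hx) ha.le))
      · obtain ⟨M, hM⟩ := hM
        have := measurable_infConv (c := fun x y => D x y ^ p)
          (fun x y => Real.rpow_nonneg (hD x y) p)
          (fun y => (hcont y).rpow_const fun _ => Or.inr (by linarith)) hM
        exact ((this.const_mul a).exp.ennreal_ofReal).aemeasurable
    have h3 := ENNReal.toReal_mono ENNReal.ofReal_ne_top h2
    rwa [ENNReal.toReal_mul, ENNReal.toReal_ofReal (Real.exp_pos _).le,
      ENNReal.toReal_ofReal (Real.exp_pos _).le] at h3
  -- the mean of `F` is at most `s₀`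
  have hms : m ≤ s₀ := by
    -- The slope of `t ^ p` at `s₀`: on `A`, where `F x = 0`, the convolution of `-lam * F` is at
    -- least `s₀ ^ p - lam * s₀`.
    set lam := p * s₀ ^ (p - 1) with hlam
    have hlam0 : 0 < lam := by
      have : 0 < s₀ := by positivity
      positivity
    have h1 := markov (fun x => -(lam * F x)) A (s₀ ^ p - lam * s₀) (hFm.const_mul _).neg
      ⟨lam * r, fun z => by
        rw [abs_neg, abs_mul, abs_of_pos hlam0]
        exact mul_le_mul_of_nonneg_left (hFM z) hlam0.le⟩
      (fun x hx => by
        have : Nonempty Z := ⟨x⟩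
        refine le_ciInf fun y => ?_
        have h1 := hFlip y x
        rw [hFA x hx, zero_add, hsymm y x] at h1
        have h2 := mul_le_mul_of_nonneg_left h1 hlam0.le
        have h3 := rpow_tangent_le hp hs₀pos (hD x y)
        rw [← hlam, mul_sub] at h3
        linarith)
    rw [integral_neg, integral_const_mul, ← hm] at h1
    have h2 : Real.exp (a * (s₀ ^ p - lam * s₀) - Real.log 2) ≤ Real.exp (a * -(lam * m)) := by
      refine le_trans ?_ h1
      rw [Real.exp_sub, Real.exp_log (by norm_num), div_eq_mul_one_div]
      gcongr
    have h3 := Real.exp_le_exp.1 h2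
    have h4 : (a * lam) * m ≤ (a * lam) * s₀ := by linarith
    exact le_of_mul_le_mul_left h4 (by positivity)
  -- deviations above the mean
  have hdev : μ.real {x | r ≤ F x} ≤ Real.exp (-a * (r - m) ^ p) := by
    set s := r - m with hs
    have hs0 : 0 ≤ s := by linarith
    -- The slope at `s = r - m` makes the final exponent exactly `-a * s ^ p`.
    set lam := p * s ^ (p - 1) with hlam
    have hlam0 : 0 ≤ lam := by positivity
    have h1 := markov (fun x => lam * F x) {x | r ≤ F x} (lam * r + (s ^ p - lam * s))
      (hFm.const_mul _)
      ⟨lam * r, fun z => by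
        rw [abs_mul, abs_of_nonneg hlam0]
        exact mul_le_mul_of_nonneg_left (hFM z) hlam0⟩
      (fun x hx => by
        have : Nonempty Z := ⟨x⟩
        refine le_ciInf fun y => ?_
        have hx : r ≤ F x := hx
        have h2 := mul_le_mul_of_nonneg_left (hx.trans (hFlip x y)) hlam0
        have h3 := rpow_tangent_le hp hs0 (hD x y)
        rw [← hlam, mul_sub] at h3
        linarith)
    rw [integral_const_mul, ← hm, ← le_div_iff₀' (Real.exp_pos _), ← Real.exp_sub] at h1
    refine h1.trans (Real.exp_le_exp.2 (le_of_eq ?_))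
    rw [hs]
    ring
  have hcompl : {x | r ≤ F x}ᶜ ⊆ {x | ∃ y ∈ A, D x y ≤ r} := by
    intro x hx
    have hx : F x < r := not_le.1 hx
    have hx' : ⨅ y : A, D x y < r := (min_lt_iff.1 hx).resolve_left (lt_irrefl r)
    obtain ⟨y, hy⟩ := exists_lt_of_ciInf_lt hx'
    exact ⟨y, y.2, hy.le⟩
  have h1 : μ.real {x | r ≤ F x}ᶜ = 1 - μ.real {x | r ≤ F x} :=
    probReal_compl_eq_one_sub (measurableSet_le measurable_const hFm)
  have h2 := measureReal_mono (μ := μ) hcompl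
  have h3 : Real.exp (-a * (r - m) ^ p) ≤ Real.exp (-a * (r - s₀) ^ p) := by
    refine Real.exp_le_exp.2 ?_
    have : (r - s₀) ^ p ≤ (r - m) ^ p :=
      Real.rpow_le_rpow (by linarith) (by linarith) (by linarith)
    have := mul_le_mul_of_nonneg_left this ha.le
    linarith
  linarith

end Concentration

/-! ### The `ℓ^p` product metric. -/

section LpProductDist

variable {X : Type*} [MetricSpace X] {p : ℝ} {n : ℕ}

lemma lpProductDist_nonneg (x y : Fin n → X) : 0 ≤ lpProductDist p x y := by
  unfold lpProductDist
  positivity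

lemma lpProductDist_rpow (hp : p ≠ 0) (x y : Fin n → X) :
    lpProductDist p x y ^ p = ∑ i, dist (x i) (y i) ^ p := by
  rw [lpProductDist, one_div, Real.rpow_inv_rpow (by positivity) hp]

lemma lpProductDist_self (hp : p ≠ 0) (x : Fin n → X) : lpProductDist p x x = 0 := by
  simp [lpProductDist, hp]

lemma lpProductDist_comm (x y : Fin n → X) : lpProductDist p x y = lpProductDist p y x := by
  simp [lpProductDist, dist_comm]

lemma lpProductDist_triangle (hp : 1 ≤ p) (x y z : Fin n → X) :
    lpProductDist p x z ≤ lpProductDist p x y + lpProductDist p y z := by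
  refine le_trans ?_ (Real.Lp_add_le_of_nonneg Finset.univ hp (fun i _ => dist_nonneg)
    fun i _ => dist_nonneg)
  unfold lpProductDist
  have : 0 ≤ 1 / p := by positivity
  gcongr
  exact dist_triangle _ _ _

lemma continuous_lpProductDist_left (hp : 0 ≤ p) (y : Fin n → X) :
    Continuous fun x => lpProductDist p x y := by
  refine Continuous.rpow_const ?_ fun _ => Or.inr (by positivity)
  exact continuous_finsetSum _ fun i _ =>
    ((continuous_apply i).dist continuous_const).rpow_const fun _ => Or.inr hp

end LpProductDist

lemma concentration_of_transportCost_le {X : Type*} [MetricSpace X] [PolishSpace X]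
    [MeasurableSpace X] [BorelSpace X] {μ : Measure X} [IsProbabilityMeasure μ] {p a : ℝ}
    (hp : 1 ≤ p) (ha : 0 < a)
    (h : ∀ ν ∈ finiteMomentMeasures (X := X) p,
      transportCost p ν μ ≤ ENNReal.ofReal a⁻¹ * InformationTheory.klDiv ν μ)
    {n : ℕ} {A : Set (Fin n → X)} (hA : 1 / 2 ≤ (Measure.pi fun _ : Fin n => μ).real A)
    {r : ℝ} (hr : (Real.log 2 / a) ^ (1 / p) ≤ r) :
    1 - Real.exp (-a * (r - (Real.log 2 / a) ^ (1 / p)) ^ p) ≤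
      (Measure.pi fun _ : Fin n => μ).real (lpEnlargement p A r) := by
  have hp0 : 0 < p := by linarith
  have h1 := (infConvIneq_of_transportCost_le hp0 ha h).pi ha.le (fun x y => by positivity)
    (fun y => (continuous_id.dist continuous_const).rpow_const fun _ => Or.inr hp0.le) n
  simp only [id, ← lpProductDist_rpow hp0.ne'] at h1
  exact h1.concentration hp ha lpProductDist_nonneg (lpProductDist_self hp0.ne')
    lpProductDist_comm (lpProductDist_triangle hp) (continuous_lpProductDist_left hp0.le) hA hr

/-! ### Weak lower semicontinuity of the transport cost. -/

section LowerSemicontinuity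

lemma isTightMeasureSet_range_of_tendsto {X : Type*} [TopologicalSpace X] [PolishSpace X]
    [MeasurableSpace X] [BorelSpace X] {q : ℕ → ProbabilityMeasure X} {ν : ProbabilityMeasure X}
    (hq : Tendsto q atTop (𝓝 ν)) :
    IsTightMeasureSet (range fun n => (q n : Measure X)) := by
  let := TopologicalSpace.upgradeIsCompletelyMetrizable X
  have hcomp : IsCompact (closure (range q)) :=
    hq.isCompact_insert_range.closure_of_subset (subset_insert _ _)
  refine (isTightMeasureSet_of_isCompact_closure hcomp).subset ?_
  rintro _ ⟨n, rfl⟩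
  exact ⟨q n, mem_range_self n, rfl⟩

variable {X : Type*} [MetricSpace X] [PolishSpace X] [MeasurableSpace X] [BorelSpace X] {p : ℝ}

/-- The transportation cost is weakly lower semicontinuous. -/
lemma eventually_lt_transportCost (hp : 0 ≤ p) (ν μ : ProbabilityMeasure X) {c : ℝ≥0∞}
    (hc : c < transportCost p (ν : Measure X) μ) :
    ∀ᶠ q : ProbabilityMeasure X × ProbabilityMeasure X in 𝓝 (ν, μ),
      c < transportCost p (q.1 : Measure X) q.2 := by
  by_contra hcon
  obtain ⟨q, hq, hqc⟩ := exists_seq_forall_of_frequently (not_eventually.1 hcon)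
  -- The slack between `c` and `c'` allows couplings that are only nearly optimal.
  obtain ⟨c', hcc', hc'⟩ := exists_between hc
  have hex : ∀ n, ∃ π : ProbabilityMeasure (X × X),
      ((π : Measure (X × X)).map Prod.fst = (q n).1 ∧ (π : Measure (X × X)).map Prod.snd = (q n).2) ∧
        ∫⁻ z, ENNReal.ofReal (dist z.1 z.2 ^ p) ∂(π : Measure (X × X)) < c' := by
    intro n
    have h := (not_lt.1 (hqc n)).trans_lt hcc'
    simp only [transportCost, iInf_lt_iff] at h
    obtain ⟨π, ⟨hπ, hπ'⟩, hlt⟩ := h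
    exact ⟨⟨π, hπ⟩, hπ', hlt⟩
  choose π hπ hπc using hex
  rw [nhds_prod_eq, tendsto_prod_iff'] at hq
  -- Tight marginals make the couplings tight, so a subsequence converges, and its limit couples `ν`
  -- and `μ`.
  have htight : IsTightMeasureSet {((P : ProbabilityMeasure (X × X)) : Measure (X × X)) |
      P ∈ range π} := by
    refine IsTightMeasureSet.prodMk
      ((isTightMeasureSet_range_of_tendsto hq.1).subset ?_)
      ((isTightMeasureSet_range_of_tendsto hq.2).subset ?_)
    · rintro _ ⟨_, ⟨_, ⟨n, rfl⟩, rfl⟩, rfl⟩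
      exact ⟨n, (hπ n).1.symm⟩
    · rintro _ ⟨_, ⟨_, ⟨n, rfl⟩, rfl⟩, rfl⟩
      exact ⟨n, (hπ n).2.symm⟩
  obtain ⟨π₀, -, φ, hφ, hlim⟩ := (isCompact_closure_of_isTightMeasureSet htight).tendsto_subseq
    fun n => subset_closure (mem_range_self n)
  have hfst : (π₀ : Measure (X × X)).map Prod.fst = ν := by
    have h1 := ((ProbabilityMeasure.continuous_map continuous_fst).tendsto π₀).comp hlim
    have h2 := hq.1.comp hφ.tendsto_atTop
    have h3 : (fun n => (q (φ n)).1) = fun n => (π (φ n)).map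
        (continuous_fst (X := X) (Y := X)).measurable.aemeasurable := by
      funext n
      exact Subtype.ext (hπ (φ n)).1.symm
    have h4 := tendsto_nhds_unique h1 (by simpa only [Function.comp_def, h3] using h2)
    exact congrArg (fun P : ProbabilityMeasure X => (P : Measure X)) h4
  have hsnd : (π₀ : Measure (X × X)).map Prod.snd = μ := by
    have h1 := ((ProbabilityMeasure.continuous_map continuous_snd).tendsto π₀).comp hlim
    have h2 := hq.2.comp hφ.tendsto_atTop
    have h3 : (fun n => (q (φ n)).2) = fun n => (π (φ n)).map
        (continuous_snd (X := X) (Y := X)).measurable.aemeasurable := by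
      funext n
      exact Subtype.ext (hπ (φ n)).2.symm
    have h4 := tendsto_nhds_unique h1 (by simpa only [Function.comp_def, h3] using h2)
    exact congrArg (fun P : ProbabilityMeasure X => (P : Measure X)) h4
  have hle := lintegral_le_liminf_lintegral_of_forall_isOpen_measure_le_liminf_measure
    (μ := (π₀ : Measure (X × X))) (μs := fun n => (π (φ n) : Measure (X × X)))
    (continuous_dist_rpow (X := X) hp)
    (fun z => by
      simp only [Pi.zero_apply]
      positivity)
    (fun G hG => ProbabilityMeasure.le_liminf_measure_open_of_tendsto hlim hG)
  have hle' : transportCost p (ν : Measure X) μ ≤ c' :=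
    calc transportCost p (ν : Measure X) μ
        ≤ ∫⁻ z, ENNReal.ofReal (dist z.1 z.2 ^ p) ∂(π₀ : Measure (X × X)) :=
          iInf₂_le _ ⟨inferInstance, hfst, hsnd⟩
      _ ≤ _ := hle
      _ ≤ c' := liminf_le_of_le (by isBoundedDefault) fun b hb => by
          obtain ⟨n, hn⟩ := hb.exists
          exact hn.trans (hπc _).le
  exact absurd hc' (not_lt.2 hle')

end LowerSemicontinuity

/-! ### The law of large numbers on finite powers. -/

section LawOfLargeNumbers

variable {X : Type*} [MeasurableSpace X] (ν : Measure X) [IsProbabilityMeasure ν]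

lemma map_infinitePi_fin (n : ℕ) :
    (Measure.infinitePi fun _ : ℕ => ν).map (fun ω (i : Fin n) => ω i) =
      Measure.pi fun _ : Fin n => ν := by
  have h := ProbabilityTheory.iIndepFun_infinitePi (P := fun _ : ℕ => ν)
    (X := fun _ x => x) (fun _ => measurable_id)
  have h' := (ProbabilityTheory.iIndepFun_iff_map_fun_eq_pi_map
    (fun i => (measurable_pi_apply _).aemeasurable)).1
    (h.precomp (g := fun i : Fin n => (i : ℕ)) Fin.val_injective)
  simpa [Measure.infinitePi_map_eval] using h'

/-- The weak law of large numbers on finite product spaces. -/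
lemma tendsto_measure_pi_le_abs_avg_sub {f : X → ℝ} (hfm : Measurable f) (hf : Integrable f ν)
    {ε : ℝ} (hε : 0 < ε) :
    Tendsto (fun n : ℕ => (Measure.pi fun _ : Fin n => ν)
      {x | ε ≤ |(∑ i, f (x i)) / n - ∫ y, f y ∂ν|}) atTop (𝓝 0) := by
  set P := Measure.infinitePi fun _ : ℕ => ν with hP
  have hmp : ∀ i : ℕ, MeasurePreserving (fun ω : ℕ → X => ω i) P ν := fun i =>
    measurePreserving_eval_infinitePi (fun _ : ℕ => ν) i
  have hident : ∀ i : ℕ, ProbabilityTheory.IdentDistrib (fun ω : ℕ → X => f (ω i))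
      (fun ω => f (ω 0)) P P := by
    intro i
    refine ⟨(hfm.comp (measurable_pi_apply _)).aemeasurable,
      (hfm.comp (measurable_pi_apply _)).aemeasurable, ?_⟩
    have key : ∀ j : ℕ, P.map (fun ω : ℕ → X => f (ω j)) = ν.map f := fun j => by
      rw [← (hmp j).map_eq, Measure.map_map hfm (measurable_pi_apply j)]
      rfl
    rw [key, key]
  have hind := ProbabilityTheory.iIndepFun_infinitePi (P := fun _ : ℕ => ν)
    (X := fun _ => f) (fun _ => hfm)
  have hslln := ProbabilityTheory.strong_law_ae_real (μ := P) (fun i ω => f (ω i))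
    ((hmp 0).integrable_comp_of_integrable hf) (fun i j hij => hind.indepFun hij) hident
  have hmean : ∫ ω, f (ω 0) ∂P = ∫ y, f y ∂ν := by
    rw [← (hmp 0).map_eq, integral_map (hmp 0).measurable.aemeasurable hfm.aestronglyMeasurable]
  have htim := tendstoInMeasure_of_tendsto_ae
    (fun n => (Measurable.aestronglyMeasurable (by fun_prop) :
      AEStronglyMeasurable (fun ω : ℕ → X => (∑ i ∈ Finset.range n, f (ω i)) / (n : ℝ)) P)) hslln
  rw [tendstoInMeasure_iff_norm] at htim
  refine (htim ε hε).congr fun n => ?_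
  rw [← map_infinitePi_fin ν n, Measure.map_apply]
  · congr 1
    ext ω
    simp only [mem_ofPred_eq, mem_preimage, hmean, Real.norm_eq_abs, Finset.sum_range]
  · fun_prop
  · exact measurableSet_le measurable_const (by fun_prop)

end LawOfLargeNumbers

/-! ### Empirical measures, of samples of size `n + 1` so that none is empty. -/

section EmpiricalMeasure

variable {X : Type*} [MeasurableSpace X] {n : ℕ}

/-- The uniform probability measure on `Fin (n + 1)`. -/
noncomputable def uniformFin (n : ℕ) : Measure (Fin (n + 1)) :=
  ((n + 1 : ℕ) : ℝ≥0∞)⁻¹ • Measure.count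

instance : IsProbabilityMeasure (uniformFin n) := by
  refine ⟨?_⟩
  simp only [uniformFin, Measure.smul_apply, Measure.count_univ, smul_eq_mul,
    ENat.card_eq_coe_fintype_card, Fintype.card_fin]
  exact ENNReal.inv_mul_cancel (by simp) (by simp)

lemma integral_uniformFin (f : Fin (n + 1) → ℝ) :
    ∫ i, f i ∂(uniformFin n) = (∑ i, f i) / (n + 1 : ℕ) := by
  rw [uniformFin, integral_smul_measure, integral_count, ENNReal.toReal_inv,
    ENNReal.toReal_natCast, smul_eq_mul, div_eq_inv_mul]

lemma lintegral_uniformFin (f : Fin (n + 1) → ℝ≥0∞) :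
    ∫⁻ i, f i ∂(uniformFin n) = ((n + 1 : ℕ) : ℝ≥0∞)⁻¹ * ∑ i, f i := by
  rw [uniformFin, lintegral_smul_measure, lintegral_count, tsum_fintype, smul_eq_mul]

/-- The empirical measure of a sample. -/
noncomputable def empiricalMeasure (x : Fin (n + 1) → X) : ProbabilityMeasure X :=
  ⟨(uniformFin n).map x, Measure.isProbabilityMeasure_map (measurable_of_finite x).aemeasurable⟩

lemma integral_empiricalMeasure (x : Fin (n + 1) → X) {f : X → ℝ} (hf : Measurable f) :
    ∫ y, f y ∂(empiricalMeasure x : Measure X) = (∑ i, f (x i)) / (n + 1 : ℕ) := by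
  rw [← integral_uniformFin]
  exact integral_map (measurable_of_finite x).aemeasurable hf.aestronglyMeasurable

lemma continuous_empiricalMeasure [TopologicalSpace X] [OpensMeasurableSpace X] :
    Continuous fun x : Fin (n + 1) → X => empiricalMeasure x := by
  refine ProbabilityMeasure.continuous_iff_forall_continuous_integral.2 fun f => ?_
  simp only [integral_empiricalMeasure _ f.continuous.measurable]
  fun_prop

/-- The sets whose complement has vanishing probability form a filter. That it converges to `ν` can
be checked on one bounded continuous function at a time, where the weak law applies. -/
lemma tendsto_measure_pi_empiricalMeasure_notMem [TopologicalSpace X] [OpensMeasurableSpace X]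
    (ν : ProbabilityMeasure X) {U : Set (ProbabilityMeasure X)} (hU : U ∈ 𝓝 ν) :
    Tendsto (fun n : ℕ => (Measure.pi fun _ : Fin (n + 1) => (ν : Measure X))
      {x | empiricalMeasure x ∉ U}) atTop (𝓝 0) := by
  let F : Filter (ProbabilityMeasure X) := Filter.comk
    (fun s => Tendsto (fun n : ℕ => (Measure.pi fun _ : Fin (n + 1) => (ν : Measure X))
      {x | empiricalMeasure x ∈ s}) atTop (𝓝 0))
    (by simp)
    (fun t ht s hst => tendsto_of_tendsto_of_tendsto_of_le_of_le tendsto_const_nhds ht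
      (fun _ => zero_le) fun n => measure_mono fun x hx => hst hx)
    (fun s hs t ht => by
      have h := hs.add ht
      rw [add_zero] at h
      exact tendsto_of_tendsto_of_tendsto_of_le_of_le tendsto_const_nhds h
        (fun _ => zero_le) fun n => measure_union_le _ _)
  have hF : Tendsto (fun P => P) F (𝓝 ν) := by
    rw [ProbabilityMeasure.tendsto_iff_forall_integral_tendsto]
    intro f
    rw [Metric.tendsto_nhds]
    intro ε hε
    have h := (tendsto_measure_pi_le_abs_avg_sub (ν : Measure X) f.continuous.measurable
      (f.integrable _) hε).comp (tendsto_add_atTop_nat 1)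
    refine Filter.mem_comk.2 (h.congr fun n => ?_)
    simp only [Function.comp_apply]
    congr 1
    ext x
    simp only [mem_ofPred_eq, mem_compl_iff, not_lt, Real.dist_eq,
      integral_empiricalMeasure _ f.continuous.measurable]
  exact Filter.mem_comk.1 (show U ∈ F from hF hU)

/-- The coupling that matches the two samples index by index. -/
lemma transportCost_empiricalMeasure_le {X : Type*} [MetricSpace X] [PolishSpace X]
    [MeasurableSpace X] [BorelSpace X] {n : ℕ} {p : ℝ} (hp : 0 ≤ p) (x y : Fin (n + 1) → X) :
    transportCost p (empiricalMeasure x : Measure X) (empiricalMeasure y) ≤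
      ENNReal.ofReal ((∑ i, dist (x i) (y i) ^ p) / (n + 1 : ℕ)) := by
  have hxy : Measurable fun i => (x i, y i) := measurable_of_finite _
  have hfst : ((uniformFin n).map fun i => (x i, y i)).map Prod.fst = empiricalMeasure x := by
    rw [Measure.map_map measurable_fst hxy]
    rfl
  have hsnd : ((uniformFin n).map fun i => (x i, y i)).map Prod.snd = empiricalMeasure y := by
    rw [Measure.map_map measurable_snd hxy]
    rfl
  refine (iInf₂_le _ ⟨Measure.isProbabilityMeasure_map hxy.aemeasurable, hfst, hsnd⟩).trans ?_
  rw [lintegral_map (continuous_dist_rpow hp).measurable.ennreal_ofReal hxy,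
    lintegral_uniformFin, div_eq_inv_mul, ENNReal.ofReal_mul (by positivity),
    ENNReal.ofReal_inv_of_pos (by positivity), ENNReal.ofReal_natCast,
    ENNReal.ofReal_sum_of_nonneg fun i _ => by positivity]

end EmpiricalMeasure

/-! ### Change of measure between product laws. -/

section ChangeOfMeasure

variable {X : Type*} [MeasurableSpace X] {μ ν : Measure X} [IsProbabilityMeasure μ]
  [IsProbabilityMeasure ν] {n : ℕ}

lemma pi_eq_withDensity_prod_rnDeriv (h : ν ≪ μ) :
    (Measure.pi fun _ : Fin n => ν) =
      (Measure.pi fun _ : Fin n => μ).withDensity fun x => ∏ i, ν.rnDeriv μ (x i) := by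
  refine Measure.pi_eq fun s hs => ?_
  have hm := Measure.measurable_rnDeriv ν μ
  rw [withDensity_apply _ (MeasurableSet.univ_pi hs),
    ← lintegral_indicator (MeasurableSet.univ_pi hs)]
  have hind := ProbabilityTheory.iIndepFun_pi (μ := fun _ : Fin n => μ)
    (X := fun i => (s i).indicator (ν.rnDeriv μ)) fun i => (hm.indicator (hs i)).aemeasurable
  symm
  calc ∏ i, ν (s i)
      = ∏ i, ∫⁻ x, (s i).indicator (ν.rnDeriv μ) (x i) ∂(Measure.pi fun _ : Fin n => μ) := by
        refine Finset.prod_congr rfl fun i _ => ?_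
        rw [(measurePreserving_eval (fun _ : Fin n => μ) i).lintegral_comp (hm.indicator (hs i)),
          lintegral_indicator (hs i), Measure.setLIntegral_rnDeriv h]
    _ = ∫⁻ x, ∏ i, (s i).indicator (ν.rnDeriv μ) (x i) ∂(Measure.pi fun _ : Fin n => μ) :=
        (ProbabilityTheory.lintegral_prod_eq_prod_lintegral_of_indepFun _ _ hind
          fun i => (hm.indicator (hs i)).comp (measurable_pi_apply i)).symm
    _ = _ := by
        refine lintegral_congr fun x => ?_
        by_cases hx : x ∈ univ.pi s
        · rw [indicator_of_mem hx]
          exact Finset.prod_congr rfl fun i _ => indicator_of_mem (hx i (mem_univ i)) _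
        · rw [indicator_of_notMem hx]
          simp only [mem_univ_pi, not_forall] at hx
          obtain ⟨i, hi⟩ := hx
          exact Finset.prod_eq_zero (Finset.mem_univ i) (indicator_of_notMem hi _)

lemma pi_le_exp_mul_pi (h : ν ≪ μ) {C : Set (Fin n → X)} (hC : MeasurableSet C) {t : ℝ}
    (ht : ∀ x ∈ C, ∑ i, llr ν μ (x i) ≤ t) :
    (Measure.pi fun _ : Fin n => ν).real C ≤
      Real.exp t * (Measure.pi fun _ : Fin n => μ).real C := by
  have hle : (Measure.pi fun _ : Fin n => ν) C ≤
      ENNReal.ofReal (Real.exp t) * (Measure.pi fun _ : Fin n => μ) C := by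
    rw [pi_eq_withDensity_prod_rnDeriv h, withDensity_apply _ hC, ← setLIntegral_const]
    refine setLIntegral_mono_ae' hC ?_
    have hae : ∀ᵐ x ∂(Measure.pi fun _ : Fin n => μ), ∀ i, ν.rnDeriv μ (x i) < ∞ :=
      ae_all_iff.2 fun i =>
        (measurePreserving_eval (fun _ : Fin n => μ) i).quasiMeasurePreserving.ae
          (Measure.rnDeriv_lt_top ν μ)
    filter_upwards [hae] with x hx hxC
    calc ∏ i, ν.rnDeriv μ (x i) ≤ ∏ i, ENNReal.ofReal (Real.exp (llr ν μ (x i))) := by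
          refine Finset.prod_le_prod' fun i _ => ?_
          rw [← ENNReal.ofReal_toReal (hx i).ne]
          -- Only an inequality, since `Real.log 0 = 0` where the density vanishes.
          exact ENNReal.ofReal_le_ofReal (Real.le_exp_log _)
      _ = ENNReal.ofReal (Real.exp (∑ i, llr ν μ (x i))) := by
          rw [← ENNReal.ofReal_prod_of_nonneg fun i _ => (Real.exp_pos _).le, Real.exp_sum]
      _ ≤ _ := ENNReal.ofReal_le_ofReal (Real.exp_le_exp.2 (ht x hxC))
  have := ENNReal.toReal_mono (ENNReal.mul_ne_top ENNReal.ofReal_ne_top (measure_ne_top _ _)) hle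
  rwa [ENNReal.toReal_mul, ENNReal.toReal_ofReal (Real.exp_pos _).le] at this

end ChangeOfMeasure

/-! ### Comparison of exponents and the converse implication. -/

lemma tendsto_mul_sub_mul_rpow_atBot {p a c h r₀ : ℝ} (hp : 0 < p) (hc : 0 < c)
    (hh : h < a * c) :
    Tendsto (fun n : ℕ => n * h - a * (((n : ℝ) * c) ^ (1 / p) - r₀) ^ p) atTop atBot := by
  have hu : Tendsto (fun n : ℕ => c ^ (1 / p) - r₀ * (n : ℝ) ^ (-(1 / p))) atTop
      (𝓝 (c ^ (1 / p))) := by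
    have h1 := ((tendsto_rpow_neg_atTop (y := 1 / p) (by positivity)).comp
      tendsto_natCast_atTop_atTop).const_mul r₀
    simpa using h1.const_sub (c ^ (1 / p))
  have hcp : (c ^ (1 / p)) ^ p = c := by
    rw [one_div, Real.rpow_inv_rpow hc.le hp.ne']
  have hv : Tendsto (fun n : ℕ => h - a * (c ^ (1 / p) - r₀ * (n : ℝ) ^ (-(1 / p))) ^ p) atTop
      (𝓝 (h - a * c)) := by
    have h1 := (hu.rpow_const (p := p) (Or.inr hp.le)).const_mul a
    rw [hcp] at h1
    exact h1.const_sub h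
  -- Factoring out `n` leaves a bracket tending to `h - a * c < 0`; the shift `r₀` disappears in the
  -- limit.
  refine (tendsto_natCast_atTop_atTop.atTop_mul_neg (by linarith) hv).congr' ?_
  filter_upwards [eventually_gt_atTop 0, hu.eventually_const_lt (by positivity)] with n hn hun
  have hn' : (0 : ℝ) < n := by exact_mod_cast hn
  have h1 : ((n : ℝ) * c) ^ (1 / p) - r₀ =
      (n : ℝ) ^ (1 / p) * (c ^ (1 / p) - r₀ * (n : ℝ) ^ (-(1 / p))) := by
    rw [Real.mul_rpow hn'.le hc.le, Real.rpow_neg hn'.le, mul_sub]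
    have : (n : ℝ) ^ (1 / p) ≠ 0 := by positivity
    field_simp
  rw [h1, Real.mul_rpow (by positivity) hun.le, one_div, Real.rpow_inv_rpow hn'.le hp.ne']
  ring

lemma transportCost_le_of_concentration {X : Type*} [MetricSpace X] [PolishSpace X]
    [MeasurableSpace X] [BorelSpace X] {μ : Measure X} [IsProbabilityMeasure μ] {p a r₀ b : ℝ}
    (hp : 0 < p) (ha : 0 < a)
    (hconc : ∀ n : ℕ, ∀ A : Set (Fin n → X), MeasurableSet A →
        1 / 2 ≤ (Measure.pi fun _ : Fin n => μ).real A →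
        ∀ r : ℝ, r₀ ≤ r →
          1 - b * Real.exp (-a * (r - r₀) ^ p) ≤
            (Measure.pi fun _ : Fin n => μ).real (lpEnlargement p A r))
    (ν : Measure X) [IsProbabilityMeasure ν] :
    transportCost p ν μ ≤ ENNReal.ofReal a⁻¹ * InformationTheory.klDiv ν μ := by
  by_cases hkl : InformationTheory.klDiv ν μ = ∞
  · rw [hkl, ENNReal.mul_top (by simpa using ha)]
    exact le_top
  obtain ⟨hac, hint⟩ := InformationTheory.klDiv_ne_top_iff.1 hkl
  set H := ∫ x, llr ν μ x ∂ν with hH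
  have hklH : InformationTheory.klDiv ν μ = ENNReal.ofReal H := by
    rw [InformationTheory.klDiv_of_ac_of_integrable hac hint]
    simp [hH]
  have hH0 : 0 ≤ H := by
    simpa using InformationTheory.integral_llr_add_sub_measure_univ_nonneg hac hint
  by_contra hcon
  rw [not_le, hklH, ← ENNReal.ofReal_mul (by positivity)] at hcon
  obtain ⟨c', hc'1, hc'2⟩ := exists_between hcon
  obtain ⟨c, rfl⟩ : ∃ c : ℝ, c' = ENNReal.ofReal c := ⟨_, (ENNReal.ofReal_toReal hc'2.ne_top).symm⟩
  have hHc : a⁻¹ * H < c := (ENNReal.ofReal_lt_ofReal_iff_of_nonneg (by positivity)).1 hc'1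
  have hc0 : 0 < c := lt_of_le_of_lt (by positivity) hHc
  rw [inv_mul_lt_iff₀ ha] at hHc
  -- `H < h` makes log-likelihood sums at most `n * h` typical under `ν^n`; `h < a * c` lets
  -- concentration beat `exp (n * h)`.
  obtain ⟨h, hHh, hhc⟩ := exists_between hHc
  let ν' : ProbabilityMeasure X := ⟨ν, inferInstance⟩
  let μ' : ProbabilityMeasure X := ⟨μ, inferInstance⟩
  have hev := eventually_lt_transportCost hp.le ν' μ' hc'2
  rw [nhds_prod_eq] at hev
  obtain ⟨U', hU', V', hV', hUV⟩ := Filter.mem_prod_iff.1 hev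
  obtain ⟨U, hUU', hUo, hνU⟩ := mem_nhds_iff.1 hU'
  obtain ⟨V, hVV', hVo, hμV⟩ := mem_nhds_iff.1 hV'
  have hm : Measurable (llr ν μ) := measurable_llr ν μ
  have hexp : Tendsto (fun n : ℕ => b * Real.exp (((n + 1 : ℕ) : ℝ) * h -
      a * ((((n + 1 : ℕ) : ℝ) * c) ^ (1 / p) - r₀) ^ p)) atTop (𝓝 0) := by
    have h1 := (Real.tendsto_exp_atBot.comp ((tendsto_mul_sub_mul_rpow_atBot (r₀ := r₀) hp hc0
      hhc).comp (tendsto_add_atTop_nat 1))).const_mul b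
    simpa using h1
  have hr : Tendsto (fun n : ℕ => (((n + 1 : ℕ) : ℝ) * c) ^ (1 / p)) atTop atTop :=
    (tendsto_rpow_atTop (by positivity)).comp
      ((tendsto_natCast_atTop_atTop.comp (tendsto_add_atTop_nat 1)).atTop_mul_const hc0)
  have hA := tendsto_measure_pi_empiricalMeasure_notMem μ' (hVo.mem_nhds hμV)
  have hC1 := tendsto_measure_pi_empiricalMeasure_notMem ν' (hUo.mem_nhds hνU)
  have hC2 := (tendsto_measure_pi_le_abs_avg_sub ν hm hint (sub_pos.2 hHh)).comp
    (tendsto_add_atTop_nat 1)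
  have hC := hC1.add hC2
  rw [add_zero] at hC
  have hhalf : (0 : ℝ≥0∞) < ENNReal.ofReal (1 / 2) := by simp
  obtain ⟨n, hn1, hn2, hn3, hn4⟩ := ((hexp.eventually_lt_const (show (0 : ℝ) < 1 / 2 by norm_num)).and
    ((hr.eventually_ge_atTop r₀).and ((hA.eventually_lt_const hhalf).and
      (hC.eventually_lt_const hhalf)))).exists
  set r := (((n + 1 : ℕ) : ℝ) * c) ^ (1 / p) with hrdef
  set A := {x : Fin (n + 1) → X | empiricalMeasure x ∈ V} with hAdef
  set C := {x : Fin (n + 1) → X | empiricalMeasure x ∈ U} ∩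
    {x | ∑ i, llr ν μ (x i) ≤ ((n + 1 : ℕ) : ℝ) * h} with hCdef
  have hAm : MeasurableSet A := (hVo.preimage continuous_empiricalMeasure).measurableSet
  have hCm : MeasurableSet C := (hUo.preimage continuous_empiricalMeasure).measurableSet.inter
    (measurableSet_le (by fun_prop) measurable_const)
  have hA2 : 1 / 2 ≤ (Measure.pi fun _ : Fin (n + 1) => μ).real A := by
    have h1 : (Measure.pi fun _ : Fin (n + 1) => μ).real Aᶜ < 1 / 2 :=
      ENNReal.toReal_lt_of_lt_ofReal hn3
    rw [probReal_compl_eq_one_sub hAm] at h1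
    linarith
  have hC2 : 1 / 2 ≤ (Measure.pi fun _ : Fin (n + 1) => ν).real C := by
    have h1 : (Measure.pi fun _ : Fin (n + 1) => ν).real Cᶜ < 1 / 2 := by
      refine ENNReal.toReal_lt_of_lt_ofReal (lt_of_le_of_lt ?_ hn4)
      refine le_trans (measure_mono ?_) (measure_union_le _ _)
      intro x hx
      rw [hCdef, compl_inter] at hx
      refine hx.imp id fun hx => ?_
      have hx : ((n + 1 : ℕ) : ℝ) * h < ∑ i, llr ν μ (x i) := not_le.1 hx
      have h2 : h < (∑ i, llr ν μ (x i)) / ((n + 1 : ℕ) : ℝ) := by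
        rw [lt_div_iff₀' (by positivity)]
        exact hx
      show h - H ≤ |(∑ i, llr ν μ (x i)) / ((n + 1 : ℕ) : ℝ) - H|
      exact le_trans (by linarith) (le_abs_self _)
    rw [probReal_compl_eq_one_sub hCm] at h1
    linarith
  -- A point of `C` within `r` of `A` would give, by index matching, empirical measures at cost at
  -- most `r ^ p / (n + 1) = c`.
  have hdisj : lpEnlargement p A r ⊆ Cᶜ := by
    rintro x ⟨y, hy, hxy⟩ hxC
    have hlt : ENNReal.ofReal c <
        transportCost p (empiricalMeasure x : Measure X) (empiricalMeasure y) :=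
      hUV (mk_mem_prod (hUU' hxC.1) (hVV' hy))
    refine absurd (transportCost_empiricalMeasure_le hp.le x y) (not_le.2 (lt_of_le_of_lt ?_ hlt))
    refine ENNReal.ofReal_le_ofReal ?_
    rw [div_le_iff₀' (by positivity), ← lpProductDist_rpow hp.ne']
    calc lpProductDist p x y ^ p ≤ r ^ p :=
          Real.rpow_le_rpow (lpProductDist_nonneg x y) hxy hp.le
      _ = ((n + 1 : ℕ) : ℝ) * c := by
          rw [hrdef, one_div, Real.rpow_inv_rpow (by positivity) hp.ne']
  have h1 := hconc (n + 1) A hAm hA2 r hn2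
  have h2 := measureReal_mono (μ := Measure.pi fun _ : Fin (n + 1) => μ) hdisj
  rw [probReal_compl_eq_one_sub hCm] at h2
  have h3 := pi_le_exp_mul_pi (μ := μ) hac hCm (t := ((n + 1 : ℕ) : ℝ) * h) fun x hx => hx.2
  have h4 : Real.exp (((n + 1 : ℕ) : ℝ) * h) * (Measure.pi fun _ : Fin (n + 1) => μ).real C ≤
      Real.exp (((n + 1 : ℕ) : ℝ) * h) * (b * Real.exp (-a * (r - r₀) ^ p)) :=
    mul_le_mul_of_nonneg_left (by linarith) (Real.exp_pos _).le
  rw [sub_eq_add_neg, Real.exp_add, ← neg_mul] at hn1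
  linarith

theorem mainTheorem6 {X : Type*} [MetricSpace X] [PolishSpace X] [MeasurableSpace X]
    [BorelSpace X] (μ : Measure X) [IsProbabilityMeasure μ] (p : ℝ) (hp : 2 ≤ p)
    (a : ℝ) (ha : 0 < a) :
    (∃ r₀ b : ℝ, 0 ≤ r₀ ∧ 0 ≤ b ∧
      ∀ n : ℕ, ∀ A : Set (Fin n → X), MeasurableSet A →
        1 / 2 ≤ (Measure.pi fun _ : Fin n => μ).real A →
        ∀ r : ℝ, r₀ ≤ r →
          1 - b * Real.exp (-a * (r - r₀) ^ p) ≤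
            (Measure.pi fun _ : Fin n => μ).real (lpEnlargement p A r)) ↔
    (∀ ν ∈ finiteMomentMeasures (X := X) p,
      transportCost p ν μ ≤ ENNReal.ofReal a⁻¹ * InformationTheory.klDiv ν μ) := by
  constructor
  · rintro ⟨r₀, b, -, -, h⟩ ν hν
    have := hν.1
    exact transportCost_le_of_concentration (by linarith) ha h ν
  · intro h
    have hlog : 0 ≤ Real.log 2 := Real.log_nonneg (by norm_num)
    refine ⟨(Real.log 2 / a) ^ (1 / p), 1, by positivity, zero_le_one, fun n A _ hA r hr => ?_⟩
    rw [one_mul]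
    exact concentration_of_transportCost_le (by linarith) ha h hA hr
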